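/- For a non-negative integer $n$ let $b_4(n)$ be the number of $4$-regular partitions of $n$, that is, of partitions of $n$ none of whose parts is divisible by $4$ (with $b_4(0)=1$). For a complex number $q$ with $|q|<1$ and a positive integer $n$ put $E_n:=(q^n;q^n)_\infty=\prod_{k=0}^{\infty}\bigl(1-q^{n}(q^{n})^{k}\bigr)$. Then, for every complex $q$ with $|q|<1$, the series below converges and $$\sum_{n=0}^{\infty} b_4(5n+3)\,q^n = 3\,\frac{E_2^2E_{10}^6}{E_1^5E_4E_{20}^2} + q\,\frac{E_2^4E_5^5E_{20}^3}{E_1^6E_4^2E_{10}^4} + 4q^2\,\frac{E_2^3E_{10}E_{20}^3}{E_1^5E_4^2}.$$ -/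

import Mathlib

/-- The infinite `q`-product `(a; q)_∞ = ∏_{k ≥ 0} (1 - a q^k)`, for complex `a` and `‖q‖ < 1`. -/
noncomputable def qProd (a q : ℂ) : ℂ := ∏' k : ℕ, (1 - a * q ^ k)

/-- For `‖q‖ < 1` the product defining `(a; q)_∞` converges (absolutely). -/
theorem multipliable_qProd (a : ℂ) {q : ℂ} (hq : ‖q‖ < 1) :
    Multipliable fun k : ℕ => (1 - a * q ^ k) := by
  have h : Summable fun k : ℕ => ‖-(a * q ^ k)‖ := by
    simpa [norm_mul, norm_pow] using
      (summable_geometric_of_lt_one (norm_nonneg q) hq).mul_left ‖a‖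
  simpa [sub_eq_add_neg] using multipliable_one_add_of_summable h

/-- `E_n = (q^n; q^n)_∞`, for a positive integer `n` and `‖q‖ < 1`. -/
noncomputable def eulerE (n : ℕ) (q : ℂ) : ℂ := qProd (q ^ n) (q ^ n)

/-- `b_ℓ(n)`: the number of `ℓ`-regular partitions of `n`, that is, of the partitions of `n` none of
whose parts is divisible by `ℓ` (the empty partition of `0` is counted, so `b_ℓ(0) = 1`). -/
def numRegularPartitions (l n : ℕ) : ℕ :=
  (Nat.Partition.restricted n (fun i => ¬ l ∣ i)).card

/-! Put `φ(s) = ∑ s ^ (n ^ 2)` and `ψ(s) = ∑ s ^ (n (n + 1) / 2)`, over `n : ℤ` and `n ≥ 0`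
respectively. At `-s` the generating function of the `4`-regular partitions is `ψ(s) / φ(s)`. In the
5-dissections `φ(s) = A + 2 s B + 2 s ^ 4 C` and `ψ(s) = P + s Q + s ^ 3 R` the coefficients depend
on `y = s ^ 5` only, so an identity in `s` splits into one identity for each residue class of
exponents on letting `s` run over the fifth roots of `y`. For the quotient `u = ψ / φ` the two
equations `φ(s) u(s) = ψ(s)` and `ψ(s) u(s) = ψ(s ^ 2)`, the latter from `ψ(s) ^ 2 = φ(s) ψ(s ^ 2)`,
overdetermine the components of `u`; the same identity gives quadratic relations among `A, …, R`.
Together these express the third component of `u` by `A`, `R`, `B C`, `P Q`, `φ(y)` and `ψ(y)`.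
The Jacobi triple product turns these into Euler products, whereas `B`, `C`, `P`, `Q` themselves are
not Euler products. -/

open Filter Topology

/-! ### Infinite `q`-products -/

theorem norm_pow_lt_one {q : ℂ} (hq : ‖q‖ < 1) {n : ℕ} (hn : n ≠ 0) : ‖q ^ n‖ < 1 := by
  simpa only [norm_pow] using pow_lt_one₀ (norm_nonneg q) hq hn

theorem one_sub_ne_zero_of_norm_lt_one {z : ℂ} (hz : ‖z‖ < 1) : 1 - z ≠ 0 :=
  (isUnit_one_sub_of_norm_lt_one hz).ne_zero

theorem qProd_ne_zero {a q : ℂ} (ha : ‖a‖ < 1) (hq : ‖q‖ < 1) : qProd a q ≠ 0 := by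
  have hlt (k : ℕ) : ‖a * q ^ k‖ < 1 := by
    rw [norm_mul, norm_pow]
    exact mul_lt_one_of_nonneg_of_lt_one_left (norm_nonneg a) ha
      (pow_le_one₀ (norm_nonneg q) hq.le)
  have hsum : Summable fun k : ℕ => ‖-(a * q ^ k)‖ := by
    simpa only [norm_neg, norm_mul, norm_pow] using
      (summable_geometric_of_lt_one (norm_nonneg q) hq).mul_left ‖a‖
  simpa only [qProd, sub_eq_add_neg] using tprod_one_add_ne_zero_of_summable
    (fun k => by simpa only [← sub_eq_add_neg] using one_sub_ne_zero_of_norm_lt_one (hlt k)) hsum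

theorem tendsto_prod_range_qProd (a : ℂ) {q : ℂ} (hq : ‖q‖ < 1) :
    Tendsto (fun n : ℕ => ∏ k ∈ Finset.range n, (1 - a * q ^ k)) atTop (𝓝 (qProd a q)) :=
  (multipliable_qProd a hq).tendsto_prod_tprod_nat

theorem qProd_eq_prod_qProd_pow (a : ℂ) {q : ℂ} (hq : ‖q‖ < 1) (m : ℕ) [NeZero m] :
    qProd a q = ∏ r : Fin m, qProd (a * q ^ (r : ℕ)) (q ^ m) := by
  have hprod := (multipliable_qProd a hq).hasProd
  rw [← (Nat.divModEquiv m).symm.hasProd_iff, ← (Equiv.prodComm _ _).hasProd_iff] at hprod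
  refine (hprod.prod_fiberwise fun r => ?_).unique (hasProd_fintype _)
  refine (multipliable_qProd (a * q ^ (r : ℕ)) (norm_pow_lt_one hq (NeZero.ne m))).hasProd.congr_fun
    fun k => ?_
  simp only [Function.comp_apply, Equiv.prodComm_apply, Prod.swap, Nat.divModEquiv_symm_apply]
  ring

theorem qProd_mul_qProd_neg (a : ℂ) {q : ℂ} (hq : ‖q‖ < 1) :
    qProd a q * qProd (-a) q = qProd (a ^ 2) (q ^ 2) := by
  rw [qProd, qProd, qProd, ← (multipliable_qProd a hq).tprod_mul (multipliable_qProd (-a) hq)]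
  exact tprod_congr fun k => by ring

theorem eulerE_pow (n k : ℕ) (q : ℂ) : eulerE n (q ^ k) = eulerE (k * n) q := by
  simp only [eulerE, pow_mul]

theorem eulerE_neg {n : ℕ} (hn : Even n) (q : ℂ) : eulerE n (-q) = eulerE n q := by
  simp only [eulerE, hn.neg_pow]

theorem eulerE_zero_right {n : ℕ} (hn : n ≠ 0) : eulerE n 0 = 1 := by
  simp [eulerE, qProd, hn]

theorem eulerE_ne_zero {q : ℂ} (hq : ‖q‖ < 1) {n : ℕ} (hn : n ≠ 0) : eulerE n q ≠ 0 :=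
  qProd_ne_zero (norm_pow_lt_one hq hn) (norm_pow_lt_one hq hn)

theorem qProd_sq_mul_eulerE_two {q : ℂ} (hq : ‖q‖ < 1) :
    qProd q (q ^ 2) * eulerE 2 q = eulerE 1 q := by
  have h := qProd_eq_prod_qProd_pow q hq 2
  simp only [Fin.prod_univ_two, Fin.val_zero, Fin.val_one, pow_zero, mul_one, pow_one, ← sq] at h
  simp only [eulerE, pow_one, h]

theorem qProd_neg_mul_eulerE_one {q : ℂ} (hq : ‖q‖ < 1) :
    qProd (-q) q * eulerE 1 q = eulerE 2 q := by
  simpa only [eulerE, pow_one, mul_comm] using qProd_mul_qProd_neg q hq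

theorem qProd_neg_sq_mul_eulerE {q : ℂ} (hq : ‖q‖ < 1) :
    qProd (-q) (q ^ 2) * (eulerE 1 q * eulerE 4 q) = eulerE 2 q ^ 2 := by
  have hq2 := norm_pow_lt_one hq two_ne_zero
  have h1 := qProd_sq_mul_eulerE_two hq
  have h2 : qProd (q ^ 2) ((q ^ 2) ^ 2) * eulerE 4 q = eulerE 2 q := by
    simpa only [eulerE_pow, Nat.reduceMul] using qProd_sq_mul_eulerE_two hq2
  have h3 := qProd_mul_qProd_neg q hq2
  linear_combination -qProd (-q) (q ^ 2) * eulerE 4 q * h1 + eulerE 2 q * eulerE 4 q * h3 +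
    eulerE 2 q * h2

theorem eulerE_one_neg_mul {q : ℂ} (hq : ‖q‖ < 1) :
    eulerE 1 (-q) * (eulerE 1 q * eulerE 4 q) = eulerE 2 q ^ 3 := by
  have h1 : qProd (-q) (q ^ 2) * eulerE 2 q = eulerE 1 (-q) := by
    simpa only [neg_sq, eulerE_neg even_two] using
      qProd_sq_mul_eulerE_two (q := -q) (by rwa [norm_neg])
  linear_combination eulerE 2 q * qProd_neg_sq_mul_eulerE hq - eulerE 1 q * eulerE 4 q * h1

/-! ### Gaussian binomial coefficients -/

section GaussBinom

variable {R : Type*} [CommRing R] (x : R)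

/-- The finite `q`-Pochhammer symbol `(x; x)_n`, the `q`-factorial up to a power of `1 - x`. -/
def qFactor (n : ℕ) : R := ∏ k ∈ Finset.range n, (1 - x * x ^ k)

theorem qFactor_succ (n : ℕ) : qFactor x (n + 1) = qFactor x n * (1 - x * x ^ n) :=
  Finset.prod_range_succ _ _

/-- The Gaussian binomial coefficient of `n` and `k` with parameter `x`. It is defined by the
`q`-Pascal recursion, so that it makes sense even when `(x; x)_k` is not invertible. -/
def gaussBinom : ℕ → ℕ → R
  | _, 0 => 1
  | 0, _ + 1 => 0
  | n + 1, k + 1 => gaussBinom n k + x ^ (k + 1) * gaussBinom n (k + 1)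

@[simp]
theorem gaussBinom_zero_right (n : ℕ) : gaussBinom x n 0 = 1 := by
  cases n <;> rfl

theorem gaussBinom_succ_succ (n k : ℕ) :
    gaussBinom x (n + 1) (k + 1) = gaussBinom x n k + x ^ (k + 1) * gaussBinom x n (k + 1) := rfl

theorem gaussBinom_eq_zero_of_lt : ∀ {n k : ℕ}, n < k → gaussBinom x n k = 0
  | 0, _ + 1, _ => rfl
  | n + 1, k + 1, h => by
    rw [gaussBinom_succ_succ, gaussBinom_eq_zero_of_lt (by omega),
      gaussBinom_eq_zero_of_lt (by omega), mul_zero, add_zero]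

theorem gaussBinom_self : ∀ n : ℕ, gaussBinom x n n = 1
  | 0 => rfl
  | n + 1 => by
    rw [gaussBinom_succ_succ, gaussBinom_self n, gaussBinom_eq_zero_of_lt x n.lt_succ_self,
      mul_zero, add_zero]

theorem gaussBinom_add_mul_qFactor : ∀ m k : ℕ,
    gaussBinom x (m + k) k * (qFactor x m * qFactor x k) = qFactor x (m + k)
  | m, 0 => by simp [qFactor]
  | 0, k + 1 => by simp [gaussBinom_self, qFactor]
  | m + 1, k + 1 => by
    have h1 := gaussBinom_add_mul_qFactor (m + 1) k
    have h2 := gaussBinom_add_mul_qFactor m (k + 1)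
    rw [show m + 1 + k = m + k + 1 by omega] at h1
    rw [← add_assoc] at h2
    rw [show m + 1 + (k + 1) = m + k + 1 + 1 by omega, gaussBinom_succ_succ]
    rw [qFactor_succ x m] at h1 ⊢
    rw [qFactor_succ x k] at h2 ⊢
    rw [qFactor_succ x (m + k + 1)]
    linear_combination (1 - x * x ^ k) * h1 + x ^ (k + 1) * (1 - x * x ^ m) * h2

theorem sum_gaussBinom_succ_mul (n : ℕ) (w : ℕ → R) :
    ∑ j ∈ Finset.range (n + 2), gaussBinom x (n + 1) j * w j =
      ∑ j ∈ Finset.range (n + 1), gaussBinom x n j * (w (j + 1) + x ^ j * w j) := by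
  have htail : ∑ j ∈ Finset.range (n + 1), gaussBinom x n j * (x ^ j * w j) =
      ∑ j ∈ Finset.range (n + 1), x ^ (j + 1) * gaussBinom x n (j + 1) * w (j + 1) + w 0 := by
    have h := Finset.sum_range_succ (fun j => gaussBinom x n j * (x ^ j * w j)) (n + 1)
    rw [gaussBinom_eq_zero_of_lt x n.lt_succ_self, zero_mul, add_zero] at h
    rw [← h, Finset.sum_range_succ']
    simp only [gaussBinom_zero_right, pow_zero, one_mul]
    congr 1
    exact Finset.sum_congr rfl fun j _ => by ring
  rw [Finset.sum_range_succ']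
  simp only [gaussBinom_succ_succ, gaussBinom_zero_right, add_mul, mul_add,
    Finset.sum_add_distrib, one_mul]
  rw [htail, add_assoc]

theorem prod_one_add_mul_pow_eq_sum_gaussBinom (M : ℕ) : ∀ a : R,
    ∏ k ∈ Finset.range M, (1 + a * x ^ k) =
      ∑ j ∈ Finset.range (M + 1), gaussBinom x M j * (a ^ j * x ^ j.choose 2) := by
  induction M with
  | zero => simp
  | succ M ih =>
    intro a
    have hshift (k : ℕ) : 1 + a * x ^ (k + 1) = 1 + a * x * x ^ k := by ring
    rw [Finset.prod_range_succ']
    simp only [hshift, ih (a * x), sum_gaussBinom_succ_mul, Finset.sum_mul]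
    refine Finset.sum_congr rfl fun j _ => ?_
    rw [Nat.choose_succ_succ' j 1, Nat.choose_one_right]
    ring

end GaussBinom

/-! ### The Jacobi triple product -/

theorem two_mul_choose_two (n : ℤ) : 2 * Ring.choose n 2 = n * (n - 1) := by
  have h := Ring.descPochhammer_eq_factorial_smul_choose n 2
  simpa [descPochhammer_succ_right, Polynomial.smeval_mul, Polynomial.smeval_sub,
    Polynomial.smeval_X, mul_comm] using h.symm

theorem choose_two_add_one (n : ℤ) : Ring.choose (n + 1) 2 = Ring.choose n 2 + n := by
  linarith [two_mul_choose_two n, two_mul_choose_two (n + 1)]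

section ThetaTerm

variable {K : Type*} [Field K]

/-- The general term `a ^ n * x ^ (n (n - 1) / 2)` of a bilateral theta series. -/
def thetaTerm (a x : K) (n : ℤ) : K := a ^ n * x ^ Ring.choose n 2

variable {a x : K} (ha : a ≠ 0) (hx : x ≠ 0)
include ha hx

theorem thetaTerm_ne_zero (n : ℤ) : thetaTerm a x n ≠ 0 :=
  mul_ne_zero (zpow_ne_zero _ ha) (zpow_ne_zero _ hx)

theorem thetaTerm_add_one (n : ℤ) : thetaTerm a x (n + 1) = a * x ^ n * thetaTerm a x n := by
  rw [thetaTerm, thetaTerm, choose_two_add_one, zpow_add_one₀ ha, zpow_add₀ hx]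
  ring

theorem prod_mul_prod_eq_sum_gaussBinom_mul_thetaTerm (M N : ℕ) :
    (∏ k ∈ Finset.range M, (1 + a * x ^ k)) * ∏ k ∈ Finset.range N, (1 + x / a * x ^ k) =
      ∑ j ∈ Finset.range (M + N + 1), gaussBinom x (M + N) j * thetaTerm a x (j - N) := by
  induction N with
  | zero =>
    rw [Finset.prod_range_zero, mul_one, prod_one_add_mul_pow_eq_sum_gaussBinom]
    refine Finset.sum_congr rfl fun j _ => ?_
    simp only [thetaTerm, Nat.cast_zero, sub_zero, Ring.choose_natCast, zpow_natCast, add_zero]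
  | succ N ih =>
    rw [Finset.prod_range_succ, ← mul_assoc, ih, ← add_assoc, sum_gaussBinom_succ_mul,
      Finset.sum_mul]
    refine Finset.sum_congr rfl fun j _ => ?_
    have hstep := thetaTerm_add_one ha hx ((j : ℤ) - (N + 1))
    rw [show (j : ℤ) - (N + 1) + 1 = j - N by ring, zpow_sub₀ hx, zpow_natCast,
      ← Nat.cast_add_one N, zpow_natCast] at hstep
    push_cast at hstep ⊢
    rw [add_sub_add_right_eq_sub, hstep]
    field_simp
    ring

end ThetaTerm

theorem summable_norm_of_ratio {f : ℕ → ℂ} (hf : ∀ n, f n ≠ 0) {c q : ℂ} (hq : ‖q‖ < 1)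
    (hratio : ∀ n, f (n + 1) = c * q ^ n * f n) : Summable fun n => ‖f n‖ := by
  refine summable_of_ratio_test_tendsto_lt_one (l := 0) zero_lt_one
    (Eventually.of_forall fun n => norm_ne_zero_iff.2 (hf n)) ?_
  have hnorm (n : ℕ) : ‖‖f (n + 1)‖‖ / ‖‖f n‖‖ = ‖c‖ * ‖q‖ ^ n := by
    rw [hratio, norm_norm, norm_norm, norm_mul, norm_mul, norm_pow,
      mul_div_cancel_right₀ _ (norm_ne_zero_iff.2 (hf n))]
  simp only [hnorm]
  simpa only [mul_zero] using
    (tendsto_pow_atTop_nhds_zero_of_lt_one (norm_nonneg q) hq).const_mul ‖c‖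

theorem summable_norm_thetaTerm {a x : ℂ} (ha : a ≠ 0) (hx0 : x ≠ 0) (hx : ‖x‖ < 1) :
    Summable fun n : ℤ => ‖thetaTerm a x n‖ := by
  refine Summable.of_nat_of_neg ?_ ?_
  · refine summable_norm_of_ratio (c := a) (fun n => thetaTerm_ne_zero ha hx0 n) hx fun n => ?_
    rw [Nat.cast_add_one, thetaTerm_add_one ha hx0, zpow_natCast]
  · refine summable_norm_of_ratio (c := x / a) (fun n => thetaTerm_ne_zero ha hx0 _) hx fun n => ?_
    have hstep := thetaTerm_add_one ha hx0 (-(n + 1 : ℤ))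
    rw [neg_add, neg_add_cancel_right, ← neg_add, zpow_neg, ← Nat.cast_add_one, zpow_natCast]
      at hstep
    rw [hstep]
    field_simp
    ring

theorem qFactor_ne_zero {x : ℂ} (hx : ‖x‖ < 1) (n : ℕ) : qFactor x n ≠ 0 :=
  Finset.prod_ne_zero_iff.2 fun k _ => by
    simpa only [← pow_succ'] using
      one_sub_ne_zero_of_norm_lt_one (norm_pow_lt_one hx k.succ_ne_zero)

theorem gaussBinom_add_eq {x : ℂ} (hx : ‖x‖ < 1) (m k : ℕ) :
    gaussBinom x (m + k) k = qFactor x (m + k) * ((qFactor x m)⁻¹ * (qFactor x k)⁻¹) := by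
  rw [← mul_inv, ← div_eq_mul_inv,
    eq_div_iff (mul_ne_zero (qFactor_ne_zero hx m) (qFactor_ne_zero hx k)),
    gaussBinom_add_mul_qFactor]

theorem tendsto_qFactor {x : ℂ} (hx : ‖x‖ < 1) : Tendsto (qFactor x) atTop (𝓝 (qProd x x)) :=
  tendsto_prod_range_qProd x hx

theorem tendsto_inv_qFactor {x : ℂ} (hx : ‖x‖ < 1) :
    Tendsto (fun n => (qFactor x n)⁻¹) atTop (𝓝 (qProd x x)⁻¹) :=
  (tendsto_qFactor hx).inv₀ (qProd_ne_zero hx hx)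

theorem exists_norm_gaussBinom_le {x : ℂ} (hx : ‖x‖ < 1) :
    ∃ c : ℝ, ∀ n k : ℕ, ‖gaussBinom x n k‖ ≤ c := by
  obtain ⟨b, hb⟩ := (tendsto_qFactor hx).norm.bddAbove_range
  obtain ⟨d, hd⟩ := (tendsto_inv_qFactor hx).norm.bddAbove_range
  rw [mem_upperBounds, Set.forall_mem_range] at hb hd
  have hb0 : 0 ≤ b := (norm_nonneg _).trans (hb 0)
  have hd0 : 0 ≤ d := (norm_nonneg _).trans (hd 0)
  refine ⟨b * (d * d), fun n k => ?_⟩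
  rcases lt_or_ge n k with hnk | hkn
  · rw [gaussBinom_eq_zero_of_lt x hnk, norm_zero]
    positivity
  · obtain ⟨m, rfl⟩ := Nat.exists_eq_add_of_le' hkn
    rw [gaussBinom_add_eq hx, norm_mul, norm_mul]
    gcongr
    exacts [hb _, hd _, hd _]

theorem tendsto_gaussBinom_add {x : ℂ} (hx : ‖x‖ < 1) {ι : Type*} {l : Filter ι} {m k : ι → ℕ}
    (hm : Tendsto m l atTop) (hk : Tendsto k l atTop) :
    Tendsto (fun i => gaussBinom x (m i + k i) (k i)) l (𝓝 (qProd x x)⁻¹) := by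
  have hmk : Tendsto (fun i => m i + k i) l atTop := hm.atTop_add_nonneg fun _ => Nat.zero_le _
  have h := ((tendsto_qFactor hx).comp hmk).mul
    (((tendsto_inv_qFactor hx).comp hm).mul ((tendsto_inv_qFactor hx).comp hk))
  rw [mul_inv_cancel_left₀ (qProd_ne_zero hx hx)] at h
  exact h.congr fun i => (gaussBinom_add_eq hx (m i) (k i)).symm

/-- The coefficient of `thetaTerm a x n` in the finite Jacobi triple product with `2 N` factors:
the central Gaussian binomial coefficients, with the index recentred to run over `ℤ`. -/
def centralGaussBinom {R : Type*} [CommRing R] (x : R) (N : ℕ) (n : ℤ) : R :=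
  if -(N : ℤ) ≤ n then gaussBinom x (N + N) (n + N).toNat else 0

theorem hasSum_centralGaussBinom_mul_thetaTerm {a x : ℂ} (ha : a ≠ 0) (hx : x ≠ 0) (N : ℕ) :
    HasSum (fun n : ℤ => centralGaussBinom x N n * thetaTerm a x n)
      ((∏ k ∈ Finset.range N, (1 + a * x ^ k)) * ∏ k ∈ Finset.range N, (1 + x / a * x ^ k)) := by
  have hinj : Function.Injective fun j : ℕ => (j : ℤ) - N := fun i j h => by simpa using h
  rw [← hinj.hasSum_iff fun n hn => ?_, prod_mul_prod_eq_sum_gaussBinom_mul_thetaTerm ha hx]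
  · have hcoeff (j : ℕ) : centralGaussBinom x N (j - N) = gaussBinom x (N + N) j := by
      rw [centralGaussBinom, if_pos (by omega), sub_add_cancel, Int.toNat_natCast]
    simp only [Function.comp_def, hcoeff]
    refine hasSum_sum_of_ne_finset_zero fun j hj => ?_
    rw [gaussBinom_eq_zero_of_lt x (by rw [Finset.mem_range] at hj; omega), zero_mul]
  · have hlt : ¬ -(N : ℤ) ≤ n := fun h => hn ⟨(n + N).toNat, by simp only; omega⟩
    rw [centralGaussBinom, if_neg hlt, zero_mul]

theorem tendsto_centralGaussBinom {x : ℂ} (hx : ‖x‖ < 1) (n : ℤ) :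
    Tendsto (fun N => centralGaussBinom x N n) atTop (𝓝 (qProd x x)⁻¹) := by
  have hshift (r : ℤ) : Tendsto (fun N : ℕ => (r + N).toNat) atTop atTop :=
    tendsto_atTop.2 fun b => (eventually_ge_atTop (b + r.natAbs)).mono fun N hN => by omega
  refine (tendsto_gaussBinom_add hx (hshift (-n)) (hshift n)).congr' ?_
  filter_upwards [eventually_ge_atTop n.natAbs] with N hN
  rw [centralGaussBinom, if_pos (by omega), show (-n + N).toNat + (n + N).toNat = N + N by omega]

theorem tsum_thetaTerm {a x : ℂ} (ha : a ≠ 0) (hx0 : x ≠ 0) (hx : ‖x‖ < 1) :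
    ∑' n : ℤ, thetaTerm a x n = qProd (-a) x * qProd (-(x / a)) x * qProd x x := by
  obtain ⟨c, hc⟩ := exists_norm_gaussBinom_le hx
  have hbound (N : ℕ) (n : ℤ) : ‖centralGaussBinom x N n‖ ≤ c := by
    unfold centralGaussBinom
    split_ifs
    exacts [hc _ _, norm_zero.trans_le ((norm_nonneg _).trans (hc 0 0))]
  have hseries : Tendsto (fun N => ∑' n, centralGaussBinom x N n * thetaTerm a x n) atTop
      (𝓝 (∑' n : ℤ, (qProd x x)⁻¹ * thetaTerm a x n)) := by
    refine tendsto_tsum_of_dominated_convergence ((summable_norm_thetaTerm ha hx0 hx).mul_left c)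
      (fun n => (tendsto_centralGaussBinom hx n).mul_const _) (Eventually.of_forall fun N n => ?_)
    rw [norm_mul]
    gcongr
    exact hbound N n
  have hprod := (tendsto_prod_range_qProd (-a) hx).mul (tendsto_prod_range_qProd (-(x / a)) hx)
  simp only [neg_mul, sub_neg_eq_add] at hprod
  simp only [(hasSum_centralGaussBinom_mul_thetaTerm ha hx0 _).tsum_eq] at hseries
  rw [← tendsto_nhds_unique hseries hprod, tsum_mul_left,
    mul_comm (_)⁻¹, inv_mul_cancel_right₀ (qProd_ne_zero hx hx)]

/-! ### Theta functions and their dissections -/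

/-- The exponent `i n (n + 1) / 2 + j n (n - 1) / 2` of the general term of `theta i j`. -/
def thetaExponent (i j : ℕ) (n : ℤ) : ℤ := i * n + (i + j) * Ring.choose n 2

/-- Ramanujan's theta function `f(q ^ i, q ^ j) = ∑ q ^ (i n (n + 1) / 2 + j n (n - 1) / 2)`, the
sum being over all integers `n`. Ramanujan's `φ` is `theta 1 1` and his `ψ` is `theta 1 3`. -/
noncomputable def theta (i j : ℕ) (q : ℂ) : ℂ := ∑' n : ℤ, q ^ thetaExponent i j n

theorem two_mul_thetaExponent (i j : ℕ) (n : ℤ) :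
    2 * thetaExponent i j n = (i + j) * n ^ 2 + (i - j) * n := by
  rw [thetaExponent]
  linear_combination ((i : ℤ) + j) * two_mul_choose_two n

theorem theta_comm (i j : ℕ) (q : ℂ) : theta i j q = theta j i q := by
  rw [theta, ← (Equiv.neg ℤ).tsum_eq, theta]
  refine tsum_congr fun n => congrArg (q ^ ·) ?_
  rw [Equiv.neg_apply]
  linarith [two_mul_thetaExponent i j (-n), two_mul_thetaExponent j i n]

theorem theta_pow (i j k : ℕ) (q : ℂ) : theta i j (q ^ k) = theta (k * i) (k * j) q := by
  refine tsum_congr fun n => ?_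
  rw [← zpow_natCast q k, ← zpow_mul, thetaExponent, thetaExponent]
  push_cast
  ring_nf

theorem zpow_thetaExponent_eq_thetaTerm {q : ℂ} (hq0 : q ≠ 0) (i j : ℕ) (n : ℤ) :
    q ^ thetaExponent i j n = thetaTerm (q ^ i) (q ^ (i + j)) n := by
  rw [thetaExponent, thetaTerm, zpow_add₀ hq0, zpow_mul, zpow_mul, zpow_natCast, ← Nat.cast_add,
    zpow_natCast]

section Dissection

variable {q : ℂ} (hq0 : q ≠ 0) (hq : ‖q‖ < 1)
include hq0 hq

theorem theta_eq_qProd {i j : ℕ} (hij : i + j ≠ 0) :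
    theta i j q =
      qProd (-q ^ i) (q ^ (i + j)) * qProd (-q ^ j) (q ^ (i + j)) *
        qProd (q ^ (i + j)) (q ^ (i + j)) := by
  have h := tsum_thetaTerm (pow_ne_zero i hq0) (pow_ne_zero (i + j) hq0) (norm_pow_lt_one hq hij)
  rw [pow_add q i j, mul_div_cancel_left₀ _ (pow_ne_zero i hq0), ← pow_add] at h
  simpa only [theta, zpow_thetaExponent_eq_thetaTerm hq0] using h

theorem summable_norm_zpow_thetaExponent {i j : ℕ} (hij : i + j ≠ 0) :
    Summable fun n : ℤ => ‖q ^ thetaExponent i j n‖ := by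
  simpa only [zpow_thetaExponent_eq_thetaTerm hq0] using
    summable_norm_thetaTerm (pow_ne_zero i hq0) (pow_ne_zero _ hq0) (norm_pow_lt_one hq hij)

omit hq0 hq in
theorem tsum_int_eq_sum_residues {d : ℕ} [NeZero d] {f : ℤ → ℂ} (hf : Summable f)
    (r : Fin d → ℤ) (hr : ∀ k, (d : ℤ) ∣ r k - k) :
    ∑' n, f n = ∑ k, ∑' m : ℤ, f (d * m + r k) := by
  let divMod : Fin d × ℤ ≃ ℤ := (Equiv.prodComm _ _).trans (Int.divModEquiv d).symm
  have hsum : Summable fun p => f (divMod p) := divMod.summable_iff.2 hf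
  rw [← divMod.tsum_eq f, hsum.tsum_prod, tsum_fintype]
  refine Finset.sum_congr rfl fun k _ => ?_
  obtain ⟨c, hc⟩ := hr k
  rw [← (Equiv.addRight c).tsum_eq]
  refine tsum_congr fun m => congrArg f ?_
  change (m + c) * d + (k : ℤ) = d * m + r k
  linarith

theorem theta_eq_sum_residues {i j : ℕ} (hij : i + j ≠ 0) {d : ℕ} [NeZero d] (r : Fin d → ℤ)
    (i' j' : Fin d → ℕ) (hr : ∀ k, (d : ℤ) ∣ r k - k)
    (hadd : ∀ k, i' k + j' k = d ^ 2 * (i + j))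
    (hsub : ∀ k, (i' k : ℤ) - j' k = d * (2 * r k * (i + j) + (i - j))) :
    theta i j q = ∑ k, q ^ thetaExponent i j (r k) * theta (i' k) (j' k) q := by
  rw [theta, tsum_int_eq_sum_residues (summable_norm_zpow_thetaExponent hq0 hq hij).of_norm r hr]
  refine Finset.sum_congr rfl fun k _ => ?_
  rw [theta, ← tsum_mul_left]
  refine tsum_congr fun m => ?_
  rw [← zpow_add₀ hq0]
  congr 1
  have hadd' : (i' k : ℤ) + j' k = d ^ 2 * (i + j) := by exact_mod_cast hadd k
  have h := two_mul_thetaExponent (i' k) (j' k) m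
  rw [hadd', hsub] at h
  refine mul_left_cancel₀ (two_ne_zero' ℤ) ?_
  linear_combination two_mul_thetaExponent i j (d * m + r k) - two_mul_thetaExponent i j (r k) - h

omit hq0 hq in
/-- The lattice `{(m, n) | 5 ∣ m - 2 n}` is spanned by `(2, 1)` and `(1, -2)`; the digits
`(a k, b k)` represent its five cosets. -/
theorem tsum_mul_tsum_eq_sum_cosets {f g : ℤ → ℂ} (hf : Summable fun n => ‖f n‖)
    (hg : Summable fun n => ‖g n‖) (a b : Fin 5 → ℤ) (hab : ∀ k, 5 ∣ a k - 2 * b k - (k : ℕ)) :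
    (∑' m, f m) * ∑' n, g n =
      ∑ k, ∑' v : ℤ, ∑' u : ℤ, f (2 * u + v + a k) * g (u - 2 * v + b k) := by
  let shear : ℤ × ℤ ≃ ℤ × ℤ :=
    { toFun p := (p.1 + 2 * p.2, p.2)
      invFun p := (p.1 - 2 * p.2, p.2)
      left_inv p := by simp
      right_inv p := by simp }
  have hshear (p : ℤ × ℤ) : shear p = (p.1 + 2 * p.2, p.2) := rfl
  have hsum := shear.summable_iff.2 (summable_mul_of_summable_norm hf hg)
  simp only [Function.comp_def, hshear] at hsum
  rw [tsum_mul_tsum_of_summable_norm hf hg, ← shear.tsum_eq]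
  simp only [hshear]
  rw [hsum.tsum_prod, tsum_int_eq_sum_residues hsum.prod (fun k => a k - 2 * b k) hab]
  simp only [Nat.cast_ofNat]
  refine Finset.sum_congr rfl fun k _ => tsum_congr fun v => ?_
  rw [← (Equiv.addRight (b k - 2 * v)).tsum_eq]
  refine tsum_congr fun u => ?_
  simp only [Equiv.coe_addRight]
  congr 2 <;> ring

theorem theta_sq_eq_sum_cosets {i j : ℕ} (hij : i + j ≠ 0) (a b : Fin 5 → ℤ)
    (i₁ j₁ i₂ j₂ : Fin 5 → ℕ) (hab : ∀ k, 5 ∣ a k - 2 * b k - (k : ℕ))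
    (hadd₁ : ∀ k, i₁ k + j₁ k = 5 * (i + j)) (hadd₂ : ∀ k, i₂ k + j₂ k = 5 * (i + j))
    (hsub₁ : ∀ k, (i₁ k : ℤ) - j₁ k = 2 * (i + j) * (2 * a k + b k) + 3 * (i - j))
    (hsub₂ : ∀ k, (i₂ k : ℤ) - j₂ k = 2 * (i + j) * (a k - 2 * b k) - (i - j)) :
    theta i j q ^ 2 = ∑ k, q ^ (thetaExponent i j (a k) + thetaExponent i j (b k)) *
      (theta (i₁ k) (j₁ k) q * theta (i₂ k) (j₂ k) q) := by
  have hsum := summable_norm_zpow_thetaExponent hq0 hq hij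
  rw [sq, theta, tsum_mul_tsum_eq_sum_cosets hsum hsum a b hab]
  refine Finset.sum_congr rfl fun k _ => ?_
  rw [mul_comm (theta _ _ q), theta, theta, ← tsum_mul_right, ← tsum_mul_left]
  refine tsum_congr fun v => ?_
  rw [← tsum_mul_left, ← tsum_mul_left]
  refine tsum_congr fun u => ?_
  rw [← zpow_add₀ hq0, ← zpow_add₀ hq0, ← zpow_add₀ hq0]
  congr 1
  have hadd₁' : (i₁ k : ℤ) + j₁ k = 5 * (i + j) := by exact_mod_cast hadd₁ k
  have hadd₂' : (i₂ k : ℤ) + j₂ k = 5 * (i + j) := by exact_mod_cast hadd₂ k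
  have h₁ := two_mul_thetaExponent (i₁ k) (j₁ k) u
  have h₂ := two_mul_thetaExponent (i₂ k) (j₂ k) v
  rw [hadd₁', hsub₁] at h₁
  rw [hadd₂', hsub₂] at h₂
  refine mul_left_cancel₀ (two_ne_zero' ℤ) ?_
  linear_combination two_mul_thetaExponent i j (2 * u + v + a k) +
    two_mul_thetaExponent i j (u - 2 * v + b k) - two_mul_thetaExponent i j (a k) -
    two_mul_thetaExponent i j (b k) - h₁ - h₂

end Dissection

section FifthOrder

variable {q : ℂ} (hq0 : q ≠ 0) (hq : ‖q‖ < 1)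
include hq0 hq

theorem theta_one_zero : theta 1 0 q = 2 * theta 1 3 q := by
  have h := theta_eq_sum_residues hq0 hq (i := 1) (j := 0) one_ne_zero ![0, -1] ![3, 1] ![1, 3]
    (by decide) (by decide) (by decide)
  have e0 : thetaExponent 1 0 0 = 0 := by decide
  have e1 : thetaExponent 1 0 (-1) = 0 := by decide
  simp only [Fin.sum_univ_two, Matrix.cons_val, e0, e1, zpow_zero, one_mul] at h
  rw [h, theta_comm 3 1, two_mul]

theorem theta_one_one_eq_dissection :
    theta 1 1 q =
      theta 5 5 (q ^ 5) + 2 * q * theta 3 7 (q ^ 5) + 2 * q ^ 4 * theta 1 9 (q ^ 5) := by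
  have h := theta_eq_sum_residues hq0 hq (i := 1) (j := 1) two_ne_zero ![0, 1, 2, -2, -1]
    ![25, 35, 45, 5, 15] ![25, 15, 5, 45, 35] (by decide) (by decide) (by decide)
  have e0 : thetaExponent 1 1 0 = 0 := by decide
  have e1 : thetaExponent 1 1 1 = 1 := by decide
  have e2 : thetaExponent 1 1 2 = 4 := by decide
  have e3 : thetaExponent 1 1 (-2) = 4 := by decide
  have e4 : thetaExponent 1 1 (-1) = 1 := by decide
  simp only [Fin.sum_univ_five, Matrix.cons_val, e0, e1, e2, e3, e4, zpow_ofNat] at h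
  simp only [theta_pow, Nat.reduceMul, h, theta_comm 35 15, theta_comm 45 5]
  ring

theorem theta_one_three_eq_dissection :
    theta 1 3 q = theta 2 3 (q ^ 5) + q * theta 1 4 (q ^ 5) + q ^ 3 * theta 5 15 (q ^ 5) := by
  have h := theta_eq_sum_residues hq0 hq (i := 1) (j := 0) one_ne_zero ![0, 1, 2, -2, -1]
    ![15, 20, 25, 5, 10] ![10, 5, 0, 20, 15] (by decide) (by decide) (by decide)
  have e0 : thetaExponent 1 0 0 = 0 := by decide
  have e1 : thetaExponent 1 0 1 = 1 := by decide
  have e2 : thetaExponent 1 0 2 = 3 := by decide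
  have e3 : thetaExponent 1 0 (-2) = 1 := by decide
  have e4 : thetaExponent 1 0 (-1) = 0 := by decide
  have h25 := theta_one_zero (pow_ne_zero 25 hq0) (norm_pow_lt_one hq (by norm_num : 25 ≠ 0))
  simp only [theta_pow, Nat.reduceMul] at h25
  simp only [Fin.sum_univ_five, Matrix.cons_val, e0, e1, e2, e3, e4, zpow_ofNat,
    theta_one_zero hq0 hq, theta_comm 15 10, theta_comm 20 5, h25] at h
  simp only [theta_pow, Nat.reduceMul]
  linear_combination h / 2

theorem theta_one_one_sq :
    theta 1 1 q ^ 2 = theta 5 5 q ^ 2 + 4 * q * (theta 3 7 q * theta 1 9 q) := by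
  have h := theta_sq_eq_sum_cosets hq0 hq (i := 1) (j := 1) two_ne_zero ![0, 1, 0, 0, -1]
    ![0, 0, -1, 1, 0] ![5, 9, 3, 7, 1] ![5, 1, 7, 3, 9] ![5, 7, 9, 1, 3] ![5, 3, 1, 9, 7]
    (by decide) (by decide) (by decide) (by decide) (by decide)
  have e0 : thetaExponent 1 1 0 = 0 := by decide
  have e1 : thetaExponent 1 1 1 = 1 := by decide
  have e2 : thetaExponent 1 1 (-1) = 1 := by decide
  simp only [Fin.sum_univ_five, Matrix.cons_val, e0, e1, e2, add_zero, zero_add, zpow_zero,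
    zpow_one, one_mul] at h
  rw [h, theta_comm 9 1, theta_comm 7 3]
  ring

theorem theta_one_three_sq :
    theta 1 3 q ^ 2 = theta 2 3 q * theta 1 4 q + q * theta 5 15 q ^ 2 := by
  have h := theta_sq_eq_sum_cosets hq0 hq (i := 1) (j := 0) one_ne_zero ![0, -1, 0, 1, -1]
    ![0, -1, -1, -1, 0] ![4, 1, 3, 5, 2] ![1, 4, 2, 0, 3] ![2, 3, 4, 5, 1] ![3, 2, 1, 0, 4]
    (by decide) (by decide) (by decide) (by decide) (by decide)
  have e0 : thetaExponent 1 0 0 = 0 := by decide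
  have e1 : thetaExponent 1 0 1 = 1 := by decide
  have e2 : thetaExponent 1 0 (-1) = 0 := by decide
  have h5 := theta_one_zero (pow_ne_zero 5 hq0) (norm_pow_lt_one hq (by norm_num : 5 ≠ 0))
  simp only [theta_pow, Nat.reduceMul] at h5
  simp only [Fin.sum_univ_five, Matrix.cons_val, e0, e1, e2, add_zero, zpow_zero, zpow_one,
    one_mul, theta_one_zero hq0 hq, theta_comm 4 1, theta_comm 3 2, h5] at h
  linear_combination h / 4

theorem theta_one_one_eq_qProd : theta 1 1 q = qProd (-q) (q ^ 2) ^ 2 * eulerE 2 q := by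
  rw [theta_eq_qProd hq0 hq two_ne_zero, pow_one, ← sq]
  rfl

theorem theta_one_three_eq_qProd : theta 1 3 q = qProd (-q) (q ^ 2) * eulerE 4 q := by
  have hsplit := qProd_eq_prod_qProd_pow (-q) (norm_pow_lt_one hq two_ne_zero) 2
  rw [Fin.prod_univ_two, Fin.val_zero, Fin.val_one, pow_zero, mul_one, pow_one, ← pow_mul,
    show -q * q ^ 2 = -q ^ 3 by ring] at hsplit
  rw [theta_eq_qProd hq0 hq four_ne_zero, pow_one, hsplit]
  rfl

theorem theta_three_seven_mul_theta_one_nine :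
    theta 3 7 q * theta 1 9 q * qProd (-q ^ 5) (q ^ 10) =
      qProd (-q) (q ^ 2) * eulerE 10 q ^ 2 := by
  have h37 := theta_eq_qProd hq0 hq (i := 3) (j := 7) (by decide)
  have h19 := theta_eq_qProd hq0 hq (i := 1) (j := 9) (by decide)
  have hsplit := qProd_eq_prod_qProd_pow (-q) (norm_pow_lt_one hq two_ne_zero) 5
  have hpow (k : ℕ) : -q * (q ^ 2) ^ k = -q ^ (2 * k + 1) := by ring
  simp only [Fin.prod_univ_five, hpow] at hsplit
  simp only [← pow_mul, Fin.isValue, Fin.coe_ofNat_eq_mod, Nat.reduceMod, Nat.reduceMul,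
    Nat.reduceAdd, pow_one] at h37 h19 hsplit
  rw [h37, h19, hsplit, eulerE]
  ring

theorem theta_two_three_mul_theta_one_four :
    theta 2 3 q * theta 1 4 q * qProd (-q ^ 5) (q ^ 5) = qProd (-q) q * eulerE 5 q ^ 2 := by
  have h23 := theta_eq_qProd hq0 hq (i := 2) (j := 3) (by decide)
  have h14 := theta_eq_qProd hq0 hq (i := 1) (j := 4) (by decide)
  have hsplit := qProd_eq_prod_qProd_pow (-q) hq 5
  have hpow (k : ℕ) : -q * q ^ k = -q ^ (k + 1) := by ring
  simp only [Fin.prod_univ_five, hpow, Fin.isValue, Fin.coe_ofNat_eq_mod, Nat.reduceMod,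
    Nat.reduceAdd, pow_one] at h23 h14 hsplit
  rw [h23, h14, hsplit, eulerE]
  ring

end FifthOrder

/-! ### Evaluations as Euler products -/

section ProductEvaluations

variable {q : ℂ} (hq0 : q ≠ 0) (hq : ‖q‖ < 1)
include hq0 hq

theorem theta_ne_zero {i j : ℕ} (hi : i ≠ 0) (hj : j ≠ 0) : theta i j q ≠ 0 := by
  have hij : i + j ≠ 0 := by lia
  have hlt := norm_pow_lt_one hq hij
  rw [theta_eq_qProd hq0 hq hij]
  refine mul_ne_zero (mul_ne_zero (qProd_ne_zero ?_ hlt) (qProd_ne_zero ?_ hlt))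
    (qProd_ne_zero hlt hlt)
  · simpa only [norm_neg] using norm_pow_lt_one hq hi
  · simpa only [norm_neg] using norm_pow_lt_one hq hj

theorem theta_one_three_sq_eq_mul : theta 1 3 q ^ 2 = theta 1 1 q * theta 1 3 (q ^ 2) := by
  have hq2 := norm_pow_lt_one hq two_ne_zero
  have h := qProd_neg_sq_mul_eulerE hq2
  simp only [eulerE_pow, Nat.reduceMul] at h
  rw [theta_one_three_eq_qProd hq0 hq, theta_one_one_eq_qProd hq0 hq,
    theta_one_three_eq_qProd (pow_ne_zero 2 hq0) hq2, eulerE_pow]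
  linear_combination -qProd (-q) (q ^ 2) ^ 2 * h

theorem theta_one_one_neg_mul : theta 1 1 (-q) * eulerE 2 q = eulerE 1 q ^ 2 := by
  rw [theta_one_one_eq_qProd (neg_ne_zero.2 hq0) (by rwa [norm_neg]), neg_neg, neg_sq,
    eulerE_neg even_two, ← qProd_sq_mul_eulerE_two hq]
  ring

theorem theta_one_three_neg_mul :
    theta 1 3 (-q) * eulerE 2 q = eulerE 1 q * eulerE 4 q := by
  rw [theta_one_three_eq_qProd (neg_ne_zero.2 hq0) (by rwa [norm_neg]), neg_neg, neg_sq,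
    eulerE_neg (by decide), ← qProd_sq_mul_eulerE_two hq]
  ring

theorem theta_five_five_neg_mul : theta 5 5 (-q) * eulerE 10 q = eulerE 5 q ^ 2 := by
  simpa only [← Odd.neg_pow (by decide : Odd 5), theta_pow, eulerE_pow, Nat.reduceMul] using
    theta_one_one_neg_mul (pow_ne_zero 5 hq0) (norm_pow_lt_one hq (by decide : 5 ≠ 0))

theorem theta_five_fifteen_neg_mul :
    theta 5 15 (-q) * eulerE 10 q = eulerE 5 q * eulerE 20 q := by
  simpa only [← Odd.neg_pow (by decide : Odd 5), theta_pow, eulerE_pow, Nat.reduceMul] using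
    theta_one_three_neg_mul (pow_ne_zero 5 hq0) (norm_pow_lt_one hq (by decide : 5 ≠ 0))

theorem theta_three_seven_neg_mul_theta_one_nine_neg :
    theta 3 7 (-q) * theta 1 9 (-q) * (eulerE 2 q * eulerE 5 q) =
      eulerE 1 q * eulerE 10 q ^ 3 := by
  have h := theta_three_seven_mul_theta_one_nine (neg_ne_zero.2 hq0) (by rwa [norm_neg])
  have h1 := qProd_sq_mul_eulerE_two hq
  have h5 := qProd_sq_mul_eulerE_two (norm_pow_lt_one hq (by decide : 5 ≠ 0))
  simp only [eulerE_pow, ← pow_mul, Nat.reduceMul] at h5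
  rw [Odd.neg_pow (by decide), Even.neg_pow (by decide), neg_neg, neg_neg, neg_sq,
    eulerE_neg (by decide)] at h
  linear_combination eulerE 2 q * eulerE 10 q * h + eulerE 10 q ^ 3 * h1 -
    theta 3 7 (-q) * theta 1 9 (-q) * eulerE 2 q * h5

theorem theta_two_three_neg_mul_theta_one_four_neg :
    theta 2 3 (-q) * theta 1 4 (-q) * (eulerE 2 q ^ 2 * eulerE 5 q ^ 3 * eulerE 20 q ^ 3) =
      eulerE 1 q * eulerE 4 q * eulerE 10 q ^ 8 := by
  have hneg : ‖-q‖ < 1 := by rwa [norm_neg]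
  have hq5 := norm_pow_lt_one hq (by decide : 5 ≠ 0)
  have h := theta_two_three_mul_theta_one_four (neg_ne_zero.2 hq0) hneg
  have h1 := qProd_neg_mul_eulerE_one hneg
  have h5 := qProd_neg_mul_eulerE_one (norm_pow_lt_one hneg (by decide : 5 ≠ 0))
  have hE1 := eulerE_one_neg_mul hq
  have hE5 := eulerE_one_neg_mul hq5
  have hodd : (-q) ^ 5 = -q ^ 5 := Odd.neg_pow (by decide) q
  simp only [← hodd, eulerE_pow, Nat.reduceMul, neg_neg, eulerE_neg even_two,
    eulerE_neg (by decide : Even 10)] at h h1 h5 hE1 hE5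
  have hT : theta 2 3 (-q) * theta 1 4 (-q) * (eulerE 10 q * eulerE 1 (-q)) =
      eulerE 2 q * eulerE 5 (-q) ^ 3 := by
    linear_combination eulerE 5 (-q) * eulerE 1 (-q) * h + eulerE 5 (-q) ^ 3 * h1 -
      theta 2 3 (-q) * theta 1 4 (-q) * eulerE 1 (-q) * h5
  have hcube : (eulerE 5 (-q) * (eulerE 5 q * eulerE 20 q)) ^ 3 = (eulerE 10 q ^ 3) ^ 3 := by
    rw [hE5]
  refine mul_left_cancel₀ (mul_ne_zero (eulerE_ne_zero hq two_ne_zero)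
    (eulerE_ne_zero hq (by decide : 10 ≠ 0))) ?_
  linear_combination eulerE 1 q * eulerE 4 q * eulerE 5 q ^ 3 * eulerE 20 q ^ 3 * hT -
    theta 2 3 (-q) * theta 1 4 (-q) * eulerE 10 q * eulerE 5 q ^ 3 * eulerE 20 q ^ 3 * hE1 +
    eulerE 1 q * eulerE 4 q * eulerE 2 q * hcube

end ProductEvaluations

/-! ### Components of the quotient `ψ / φ` -/

theorem norm_lt_one_of_norm_pow_lt_one {q : ℂ} {n : ℕ} (hq : ‖q ^ n‖ < 1) : ‖q‖ < 1 :=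
  lt_of_pow_lt_pow_left₀ n zero_le_one (by rwa [one_pow, ← norm_pow])

theorem eq_zero_of_forall_pow_eq {K : Type*} [Field K] [IsAlgClosed K] {n : ℕ} [NeZero (n : K)]
    {y : K} (hy : y ≠ 0) {c : Fin n → K}
    (h : ∀ s, s ^ n = y → ∑ i, c i * s ^ (i : ℕ) = 0) : c = 0 := by
  have hn : n ≠ 0 := fun hn => NeZero.ne (n : K) (by rw [hn, Nat.cast_zero])
  obtain ⟨ζ, hζ⟩ := HasEnoughRootsOfUnity.exists_primitiveRoot K n
  obtain ⟨s, hs⟩ := IsAlgClosed.exists_pow_nat_eq y (Nat.pos_of_ne_zero hn)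
  have hs0 : s ≠ 0 := by
    rintro rfl
    exact hy (by rw [← hs, zero_pow hn])
  refine Matrix.eq_zero_of_forall_index_sum_pow_mul_eq_zero (f := fun k : Fin n => ζ ^ (k : ℕ) * s)
    (fun k l hkl => Fin.ext (hζ.pow_inj k.2 l.2 (mul_right_cancel₀ hs0 hkl))) fun k => ?_
  have hroot : (ζ ^ (k : ℕ) * s) ^ n = y := by
    rw [mul_pow, pow_right_comm, hζ.pow_eq_one, one_pow, one_mul, hs]
  simpa only [mul_comm] using h _ hroot

/-- The identity `ψ(s) ^ 2 = φ(s) ψ(s ^ 2)` expressed by relations between the components of the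
5-dissections `φ(s) = A + 2 s B + 2 s ^ 4 C`, `ψ(s) = P + s Q + s ^ 3 R` and
`ψ(s ^ 2) = P' + s ^ 2 Q' + s ^ 6 R'`, where `y = s ^ 5`. -/
structure DissectionRelations {K : Type*} [CommRing K] (y A B C P Q R P' Q' R' : K) : Prop where
  sq_P : P ^ 2 = A * P' + 2 * y ^ 2 * C * R'
  sq_Q : Q ^ 2 = A * Q' + 2 * y * B * R'
  sq_R : R ^ 2 = A * R'
  P_mul_Q : P * Q = B * P' + y * C * Q'
  P_mul_R : P * R = B * Q'
  Q_mul_R : Q * R = C * P'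

theorem DissectionRelations.of_forall_pow_eq {K : Type*} [Field K] [IsAlgClosed K]
    [NeZero (2 : K)] [NeZero ((5 : ℕ) : K)] {y A B C P Q R P' Q' R' : K} (hy : y ≠ 0)
    (hR : R ^ 2 = A * R')
    (h : ∀ s, s ^ 5 = y → (P + s * Q + s ^ 3 * R) ^ 2 =
      (A + 2 * s * B + 2 * s ^ 4 * C) * (P' + s ^ 2 * Q' + s ^ 6 * R')) :
    DissectionRelations y A B C P Q R P' Q' R' := by
  have key := eq_zero_of_forall_pow_eq hy
    (c := ![P ^ 2 - A * P' - 2 * y ^ 2 * C * R',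
      2 * P * Q + y * R ^ 2 - y * A * R' - 2 * B * P' - 2 * y * C * Q',
      Q ^ 2 - A * Q' - 2 * y * B * R', 2 * P * R - 2 * B * Q', 2 * Q * R - 2 * C * P'])
    fun s hs => by
      simp only [Fin.sum_univ_five, Matrix.cons_val, Fin.isValue, Fin.coe_ofNat_eq_mod]
      linear_combination h s hs + (s * (A * R' + 2 * C * Q' - R ^ 2) + 2 * B * R' * s ^ 2 +
        2 * C * R' * (s ^ 5 + y)) * hs
  have hcoeff := congrFun key
  have h0 := hcoeff 0
  have h1 := hcoeff 1
  have h2 := hcoeff 2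
  have h3 := hcoeff 3
  have h4 := hcoeff 4
  simp only [Matrix.cons_val, Pi.zero_apply] at h0 h1 h2 h3 h4
  exact
    { sq_P := by linear_combination h0
      sq_Q := by linear_combination h2
      sq_R := hR
      P_mul_Q := mul_left_cancel₀ two_ne_zero (by linear_combination h1 - y * hR)
      P_mul_R := mul_left_cancel₀ two_ne_zero (by linear_combination h3)
      Q_mul_R := mul_left_cancel₀ two_ne_zero (by linear_combination h4) }

theorem dissectionRelations_theta {y : ℂ} (hy0 : y ≠ 0) (hy : ‖y‖ < 1) :
    DissectionRelations y (theta 5 5 y) (theta 3 7 y) (theta 1 9 y) (theta 2 3 y) (theta 1 4 y)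
      (theta 5 15 y) (theta 2 3 (y ^ 2)) (theta 1 4 (y ^ 2)) (theta 5 15 (y ^ 2)) := by
  refine .of_forall_pow_eq hy0 ?_ fun s hs => ?_
  · simpa only [pow_right_comm y 5 2, theta_pow 1 3 5, theta_pow 1 1 5] using
      theta_one_three_sq_eq_mul (pow_ne_zero 5 hy0) (norm_pow_lt_one hy (by decide : 5 ≠ 0))
  · have hs0 : s ≠ 0 := ne_zero_pow (by decide : 5 ≠ 0) (hs ▸ hy0)
    have hs1 : ‖s‖ < 1 := norm_lt_one_of_norm_pow_lt_one (hs ▸ hy)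
    have h := theta_one_three_sq_eq_mul hs0 hs1
    rwa [theta_one_three_eq_dissection hs0 hs1, theta_one_one_eq_dissection hs0 hs1,
      theta_one_three_eq_dissection (pow_ne_zero 2 hs0) (norm_pow_lt_one hs1 two_ne_zero),
      pow_right_comm s 2 5, hs, ← pow_mul s 2 3] at h

namespace DissectionRelations

variable {K : Type*} [CommRing K] {y A B C P Q R P' Q' R' : K}
  (h : DissectionRelations y A B C P Q R P' Q' R')
include h

theorem A_mul_C_mul_sq_P : A * C * P ^ 2 = A ^ 2 * Q * R + 2 * y ^ 2 * C ^ 2 * R ^ 2 := by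
  linear_combination A * C * h.sq_P - 2 * y ^ 2 * C ^ 2 * h.sq_R - A ^ 2 * h.Q_mul_R

theorem A_mul_B_mul_sq_Q : A * B * Q ^ 2 = A ^ 2 * P * R + 2 * y * B ^ 2 * R ^ 2 := by
  linear_combination A * B * h.sq_Q - 2 * y * B ^ 2 * h.sq_R - A ^ 2 * h.P_mul_R

theorem B_mul_C_mul_P_mul_Q : B * C * (P * Q) = R * (B ^ 2 * Q + y * C ^ 2 * P) := by
  linear_combination B * C * h.P_mul_Q - B ^ 2 * h.Q_mul_R - y * C ^ 2 * h.P_mul_R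

theorem sq_A_mul_B_mul_C_mul_sq_P_mul_Q :
    A ^ 2 * (B * C) * (P * Q) ^ 2 =
      A ^ 4 * (P * Q) * R ^ 2 + 2 * y * A ^ 2 * (B * C) * (P * Q) * R ^ 2 +
        4 * y ^ 3 * (B * C) ^ 2 * R ^ 4 := by
  linear_combination A ^ 2 * B * C * (Q ^ 2 * h.sq_P + (A * P' + 2 * y ^ 2 * C * R') * h.sq_Q) -
    A ^ 4 * (Q * R * h.P_mul_R + B * Q' * h.Q_mul_R) - 2 * y * A ^ 3 * B * C * R' * h.P_mul_Q -
    2 * y * A ^ 2 * B * C * P * Q * h.sq_R -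
    4 * y ^ 3 * B ^ 2 * C ^ 2 * (R ^ 2 + A * R') * h.sq_R

theorem A_mul_R_mul_cubes [IsDomain K] (hPQ : P * Q ≠ 0) :
    A * R * (B ^ 3 * P + y ^ 2 * C ^ 3 * Q) =
      A ^ 2 * (B * C) * (P * Q) - 2 * y * A ^ 2 * (B * C) * R ^ 2 +
        2 * y ^ 2 * (B * C) ^ 2 * R ^ 2 := by
  have hsq : (B * P') ^ 2 + (y * C * Q') ^ 2 = (P * Q) ^ 2 - 2 * y * (P * Q) * R ^ 2 := by
    linear_combination -(P * Q + B * P' + y * C * Q') * h.P_mul_Q +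
      2 * y * (Q * R * h.P_mul_R + B * Q' * h.Q_mul_R)
  refine mul_left_cancel₀ hPQ ?_
  linear_combination A ^ 2 * B * C * hsq + A * B ^ 3 * P ^ 2 * h.Q_mul_R +
    A * B ^ 3 * C * P' * h.sq_P + y ^ 2 * A * C ^ 3 * Q ^ 2 * h.P_mul_R +
    y ^ 2 * A * B * C ^ 3 * Q' * h.sq_Q -
    2 * y ^ 2 * B ^ 2 * C ^ 2 * (B * P' + y * C * Q') * h.sq_R -
    2 * y ^ 2 * B ^ 2 * C ^ 2 * R ^ 2 * h.P_mul_Q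

theorem A_mul_eliminant [IsDomain K] (hPQ : P * Q ≠ 0) :
    A * (A * (A ^ 2 * R ^ 2 - 4 * (B * C) * (P * Q)) +
        4 * B * (A * R * (B * Q - y * C * R) + 2 * B * P * (C * P - B * R)) +
        4 * y * C * (A * R * (C * P - B * R) + 2 * C * Q * (B * Q - y * C * R))) =
      R ^ 2 * (A ^ 2 + 4 * y * (B * C)) ^ 2 := by
  linear_combination 8 * B ^ 2 * h.A_mul_C_mul_sq_P + 8 * y * C ^ 2 * h.A_mul_B_mul_sq_Q -
    12 * A ^ 2 * h.B_mul_C_mul_P_mul_Q - 8 * h.A_mul_R_mul_cubes hPQ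

/-- The five equations say that the coefficients of `s ^ 2`, `s ^ 3`, `s ^ 4` in `φ(s) u(s) - ψ(s)`
and of `s ^ 3`, `s ^ 4` in `ψ(s) u(s) - ψ(s ^ 2)` vanish, where `u(s) = ∑ g k * s ^ k`. -/
theorem component_three [IsDomain K] {g : Fin 5 → K} (hPQ : P * Q ≠ 0) (hR : R ≠ 0)
    (hφ : A ^ 2 + 4 * y * (B * C) ≠ 0)
    (hφ₂ : A * g 2 + 2 * B * g 1 + 2 * y * C * g 3 = 0)
    (hφ₃ : A * g 3 + 2 * B * g 2 + 2 * y * C * g 4 = R)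
    (hφ₄ : A * g 4 + 2 * B * g 3 + 2 * C * g 0 = 0)
    (hψ₃ : P * g 3 + Q * g 2 + R * g 0 = 0) (hψ₄ : P * g 4 + Q * g 3 + R * g 1 = 0) :
    g 3 * A * (A ^ 2 + 4 * y * (B * C)) * (P * Q + y * R ^ 2) =
      R * (y * A ^ 2 * R ^ 2 - 3 * A ^ 2 * (P * Q) - 4 * y ^ 2 * (B * C) * R ^ 2) := by
  have h₄₂ : A * R * g 4 - 2 * C * Q * g 2 = 2 * (C * P - B * R) * g 3 := by
    linear_combination R * hφ₄ - 2 * C * hψ₃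
  have h₂₄ : A * R * g 2 - 2 * B * P * g 4 = 2 * (B * Q - y * C * R) * g 3 := by
    linear_combination R * hφ₂ - 2 * B * hψ₄
  have hsolve : g 3 * R * (A ^ 2 + 4 * y * (B * C)) ^ 2 =
      A * (A ^ 2 * R ^ 2 - 4 * (B * C) * (P * Q)) := by
    refine mul_left_cancel₀ hR ?_
    linear_combination A * (A ^ 2 * R ^ 2 - 4 * (B * C) * (P * Q)) * hφ₃ -
      g 3 * h.A_mul_eliminant hPQ -
      2 * A * B * (A * R * h₂₄ + 2 * B * P * h₄₂) -
      2 * y * A * C * (A * R * h₄₂ + 2 * C * Q * h₂₄)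
  refine mul_left_cancel₀ (mul_ne_zero (pow_ne_zero 2 hR) hφ) ?_
  linear_combination R * A * (P * Q + y * R ^ 2) * hsolve -
    4 * R * h.sq_A_mul_B_mul_C_mul_sq_P_mul_Q

end DissectionRelations

theorem DissectionRelations.component_three_of_forall_pow_eq {K : Type*} [Field K] [IsAlgClosed K]
    [NeZero ((5 : ℕ) : K)] {y A B C P Q R P' Q' R' : K}
    (h : DissectionRelations y A B C P Q R P' Q' R') (hy : y ≠ 0) (hPQ : P * Q ≠ 0) (hR : R ≠ 0)
    (hφ : A ^ 2 + 4 * y * (B * C) ≠ 0) {g : Fin 5 → K}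
    (hφg : ∀ s, s ^ 5 = y → (A + 2 * s * B + 2 * s ^ 4 * C) * ∑ k, g k * s ^ (k : ℕ) =
      P + s * Q + s ^ 3 * R)
    (hψg : ∀ s, s ^ 5 = y → (P + s * Q + s ^ 3 * R) * ∑ k, g k * s ^ (k : ℕ) =
      P' + s ^ 2 * Q' + s ^ 6 * R') :
    g 3 * A * (A ^ 2 + 4 * y * (B * C)) * (P * Q + y * R ^ 2) =
      R * (y * A ^ 2 * R ^ 2 - 3 * A ^ 2 * (P * Q) - 4 * y ^ 2 * (B * C) * R ^ 2) := by
  have hφ' := eq_zero_of_forall_pow_eq hy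
    (c := ![A * g 0 + 2 * y * B * g 4 + 2 * y * C * g 1 - P,
      A * g 1 + 2 * B * g 0 + 2 * y * C * g 2 - Q, A * g 2 + 2 * B * g 1 + 2 * y * C * g 3,
      A * g 3 + 2 * B * g 2 + 2 * y * C * g 4 - R, A * g 4 + 2 * B * g 3 + 2 * C * g 0])
    fun s hs => by
      have h := hφg s hs
      simp only [Fin.sum_univ_five, Matrix.cons_val, Fin.isValue, Fin.coe_ofNat_eq_mod] at h ⊢
      linear_combination
        h - (2 * B * g 4 + 2 * C * (g 1 + s * g 2 + s ^ 2 * g 3 + s ^ 3 * g 4)) * hs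
  have hψ' := eq_zero_of_forall_pow_eq hy
    (c := ![P * g 0 + y * Q * g 4 + y * R * g 2 - P', P * g 1 + Q * g 0 + y * R * g 3 - y * R',
      P * g 2 + Q * g 1 + y * R * g 4 - Q', P * g 3 + Q * g 2 + R * g 0,
      P * g 4 + Q * g 3 + R * g 1])
    fun s hs => by
      have h := hψg s hs
      simp only [Fin.sum_univ_five, Matrix.cons_val, Fin.isValue, Fin.coe_ofNat_eq_mod] at h ⊢
      linear_combination h - (Q * g 4 + R * (g 2 + s * g 3 + s ^ 2 * g 4) - s * R') * hs
  have hφ₂ := congrFun hφ' 2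
  have hφ₃ := congrFun hφ' 3
  have hφ₄ := congrFun hφ' 4
  have hψ₃ := congrFun hψ' 3
  have hψ₄ := congrFun hψ' 4
  simp only [Matrix.cons_val, Pi.zero_apply] at hφ₂ hφ₃ hφ₄ hψ₃ hψ₄
  exact h.component_three hPQ hR hφ hφ₂ (sub_eq_zero.1 hφ₃) hφ₄ hψ₃ hψ₄

theorem theta_quotient_component_three {y : ℂ} (hy0 : y ≠ 0) (hy : ‖y‖ < 1) {g : Fin 5 → ℂ}
    (hg : ∀ s, s ^ 5 = y → theta 1 1 s * ∑ k, g k * s ^ (k : ℕ) = theta 1 3 s) :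
    g 3 * theta 5 5 y * theta 1 1 y ^ 2 * theta 1 3 y ^ 2 =
      theta 5 15 y * (y * theta 5 5 y ^ 2 * theta 5 15 y ^ 2 -
        3 * theta 5 5 y ^ 2 * (theta 2 3 y * theta 1 4 y) -
        4 * y ^ 2 * (theta 3 7 y * theta 1 9 y) * theta 5 15 y ^ 2) := by
  have hne {i j : ℕ} (hi : i ≠ 0) (hj : j ≠ 0) := theta_ne_zero hy0 hy hi hj
  have hroot {s : ℂ} (hs : s ^ 5 = y) : s ≠ 0 ∧ ‖s‖ < 1 :=
    ⟨ne_zero_pow (by decide : 5 ≠ 0) (hs ▸ hy0), norm_lt_one_of_norm_pow_lt_one (hs ▸ hy)⟩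
  rw [theta_one_one_sq hy0 hy, theta_one_three_sq hy0 hy]
  refine (dissectionRelations_theta hy0 hy).component_three_of_forall_pow_eq hy0
    (mul_ne_zero (hne ?_ ?_) (hne ?_ ?_)) (hne ?_ ?_) ?_ (fun s hs => ?_) fun s hs => ?_
  any_goals decide
  · rw [← theta_one_one_sq hy0 hy]
    exact pow_ne_zero 2 (hne one_ne_zero one_ne_zero)
  · obtain ⟨hs0, hs1⟩ := hroot hs
    rw [← hs, ← theta_one_one_eq_dissection hs0 hs1, ← theta_one_three_eq_dissection hs0 hs1,
      hg s hs]
  · obtain ⟨hs0, hs1⟩ := hroot hs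
    have h2 := theta_one_three_eq_dissection (pow_ne_zero 2 hs0) (norm_pow_lt_one hs1 two_ne_zero)
    rw [pow_right_comm s 2 5, ← pow_mul s 2 3] at h2
    rw [← hs, ← theta_one_three_eq_dissection hs0 hs1, ← h2]
    refine mul_left_cancel₀ (theta_ne_zero hs0 hs1 one_ne_zero one_ne_zero) ?_
    rw [← theta_one_three_sq_eq_mul hs0 hs1, mul_left_comm, hg s hs, sq]

/-! ### Generating functions of restricted partitions -/

section GeneratingFunctions

open PowerSeries PowerSeries.WithPiTopology

theorem hasSum_of_tendsto_of_norm_le {α ι E : Type*} [NormedAddCommGroup E] [CompleteSpace E]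
    {l : Filter α} [l.NeBot] {f : α → ι → E} {g : ι → E} {w : α → E} {W : E} {K : ℝ}
    (hfg : ∀ i, Tendsto (f · i) l (𝓝 (g i))) (hle : ∀ a i, ‖f a i‖ ≤ ‖g i‖)
    (hK : ∀ᶠ a in l, ∀ u : Finset ι, ∑ i ∈ u, ‖f a i‖ ≤ K)
    (hf : ∀ a, HasSum (f a) (w a)) (hw : Tendsto w l (𝓝 W)) : HasSum g W := by
  have hg : Summable fun i => ‖g i‖ := by
    refine summable_of_sum_le (c := K) (fun i => norm_nonneg _) fun u => ?_
    exact le_of_tendsto (tendsto_finsetSum u fun i _ => (hfg i).norm) (hK.mono fun a ha => ha u)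
  have hlim := tendsto_tsum_of_dominated_convergence hg hfg (Eventually.of_forall fun a => hle a)
  simp only [(hf _).tsum_eq] at hlim
  exact tendsto_nhds_unique hlim hw ▸ hg.of_norm.hasSum

theorem coeff_prod_le_coeff_prod {ι : Type*} {F : ι → ℕ⟦X⟧} (hF : ∀ i, constantCoeff (F i) = 1)
    {s t : Finset ι} (hst : s ⊆ t) (n : ℕ) :
    (∏ i ∈ s, F i).coeff n ≤ (∏ i ∈ t, F i).coeff n := by
  classical
  have hconst : (∏ i ∈ t \ s, F i).coeff 0 = 1 := by
    rw [coeff_zero_eq_constantCoeff_apply, map_prod, Finset.prod_congr rfl fun i _ => hF i,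
      Finset.prod_const_one]
  calc (∏ i ∈ s, F i).coeff n
      = (∏ i ∈ t \ s, F i).coeff 0 * (∏ i ∈ s, F i).coeff n := by rw [hconst, one_mul]
    _ ≤ (∏ i ∈ t, F i).coeff n := by
        rw [← Finset.prod_sdiff hst, coeff_mul]
        exact Finset.single_le_sum
          (f := fun p : ℕ × ℕ => (∏ i ∈ t \ s, F i).coeff p.1 * (∏ i ∈ s, F i).coeff p.2)
          (fun p _ => Nat.zero_le _)
          (Finset.HasAntidiagonal.mem_antidiagonal.2 (zero_add n) :
            ((0, n) : ℕ × ℕ) ∈ Finset.HasAntidiagonal.antidiagonal n)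

/-- The series `f`, with natural coefficients, converges at `z` to `v`. -/
def HasValueAt (f : ℕ⟦X⟧) (z v : ℂ) : Prop :=
  HasSum (fun n : ℕ => (f.coeff n : ℂ) * z ^ n) v

namespace HasValueAt

variable {f g : ℕ⟦X⟧} {z v w : ℂ}

theorem one (z : ℂ) : HasValueAt 1 z 1 := by
  have h := hasSum_single (f := fun n : ℕ => ((1 : ℕ⟦X⟧).coeff n : ℂ) * z ^ n) 0
    fun n hn => by rw [coeff_one, if_neg hn, Nat.cast_zero, zero_mul]
  rwa [coeff_zero_one, Nat.cast_one, one_mul, pow_zero] at h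

theorem mul (hf : HasValueAt f z v) (hg : HasValueAt g z w) : HasValueAt (f * g) z (v * w) := by
  have hcoeff : ∀ n : ℕ, ((f * g).coeff n : ℂ) * z ^ n =
      ∑ p ∈ Finset.HasAntidiagonal.antidiagonal n,
        (f.coeff p.1 : ℂ) * z ^ p.1 * ((g.coeff p.2 : ℂ) * z ^ p.2) := fun n => by
    rw [coeff_mul, Nat.cast_sum, Finset.sum_mul]
    refine Finset.sum_congr rfl fun p hp => ?_
    rw [← Finset.HasAntidiagonal.mem_antidiagonal.1 hp, pow_add, Nat.cast_mul]
    ring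
  have hfs := Summable.norm hf.summable
  have hgs := Summable.norm hg.summable
  have hsum := (summable_norm_sum_mul_antidiagonal_of_summable_norm hfs hgs).of_norm.hasSum
  rwa [← tsum_mul_tsum_eq_tsum_sum_antidiagonal_of_summable_norm hfs hgs, hf.tsum_eq, hg.tsum_eq,
    ← funext hcoeff] at hsum

theorem prod {ι : Type*} {F : ι → ℕ⟦X⟧} {v : ι → ℂ} (h : ∀ i, HasValueAt (F i) z (v i))
    (s : Finset ι) : HasValueAt (∏ i ∈ s, F i) z (∏ i ∈ s, v i) := by
  classical
  induction s using Finset.induction_on with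
  | empty => exact one z
  | insert i s hi ih =>
    rw [Finset.prod_insert hi, Finset.prod_insert hi]
    exact (h i).mul ih

theorem sum_norm_le {r : ℂ} (h : HasValueAt f ‖z‖ r) (u : Finset ℕ) :
    ∑ n ∈ u, ‖(f.coeff n : ℂ) * z ^ n‖ ≤ ‖r‖ := by
  have hterm : ∀ n : ℕ, (f.coeff n : ℂ) * (‖z‖ : ℂ) ^ n = ((‖(f.coeff n : ℂ) * z ^ n‖ : ℝ) : ℂ) :=
    fun n => by
      rw [norm_mul, norm_pow, Complex.norm_natCast, Complex.ofReal_mul, Complex.ofReal_pow,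
        Complex.ofReal_natCast]
  have hnorm : HasSum (fun n => ‖(f.coeff n : ℂ) * z ^ n‖) r.re := by
    simpa only [hterm, Complex.ofReal_re] using Complex.hasSum_re h
  exact (sum_le_hasSum u (fun n _ => norm_nonneg _) hnorm).trans (Complex.re_le_norm r)

-- The coefficients of the partial products increase, so convergence at `‖z‖` dominates them.
theorem of_hasProd {ι : Type*} {F : ι → ℕ⟦X⟧} {G : ℕ⟦X⟧} (hFG : HasProd F G)
    (hF : ∀ i, constantCoeff (F i) = 1) {V : ℂ} {r v : ι → ℂ}
    (hFr : ∀ i, HasValueAt (F i) ‖z‖ (r i)) (hr : Multipliable r)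
    (hFv : ∀ i, HasValueAt (F i) z (v i)) (hv : HasProd v V) : HasValueAt G z V := by
  have hcoeff : ∀ n, Tendsto (fun s : Finset ι => (∏ i ∈ s, F i).coeff n) atTop (𝓝 (G.coeff n)) :=
    (tendsto_iff_coeff_tendsto ℕ _ _ _).1 hFG
  have hmono : ∀ n, Monotone fun s : Finset ι => (∏ i ∈ s, F i).coeff n := fun n _ _ hst =>
    coeff_prod_le_coeff_prod hF hst n
  have hbound : ∀ᶠ s : Finset ι in atTop, ‖∏ i ∈ s, r i‖ < ‖∏' i, r i‖ + 1 :=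
    (Tendsto.norm (a := ∏' i, r i) hr.hasProd).eventually_lt_const (lt_add_one _)
  refine hasSum_of_tendsto_of_norm_le (l := atTop) (K := ‖∏' i, r i‖ + 1) (fun n => ?_)
    (fun s n => ?_) (hbound.mono fun s hs u => ?_) (HasValueAt.prod hFv) hv
  · exact ((continuous_of_discreteTopology.tendsto _).comp (hcoeff n)).mul_const (z ^ n)
  · rw [norm_mul, norm_mul, Complex.norm_natCast, Complex.norm_natCast]
    gcongr
    exact (hmono n).ge_of_tendsto (hcoeff n) s
  · exact ((HasValueAt.prod hFr s).sum_norm_le u).trans hs.le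

end HasValueAt

theorem hasSum_X_pow_mul {d : ℕ} (hd : d ≠ 0) :
    HasSum (fun j : ℕ => (X : ℕ⟦X⟧) ^ (d * j))
      (PowerSeries.mk fun n => if d ∣ n then 1 else 0) := by
  refine (hasSum_iff_hasSum_coeff ℕ).2 fun n => ?_
  simp only [coeff_X_pow, coeff_mk]
  split_ifs with h
  · obtain ⟨k, rfl⟩ := h
    simp only [mul_right_inj' hd]
    exact hasSum_ite_eq' k 1
  · have hne : ∀ j, n ≠ d * j := fun j hj => h ⟨j, hj⟩
    simp only [hne, if_false]
    exact hasSum_zero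

theorem hasValueAt_tsum_X_pow_mul {d : ℕ} (hd : d ≠ 0) {z : ℂ} (hz : ‖z‖ < 1) :
    HasValueAt (∑' j : ℕ, X ^ (d * j)) z (1 - z ^ d)⁻¹ := by
  rw [(hasSum_X_pow_mul hd).tsum_eq, HasValueAt, ← (mul_right_injective₀ hd).hasSum_iff]
  · simpa [Function.comp_def, pow_mul] using
      hasSum_geometric_of_norm_lt_one (norm_pow_lt_one hz hd)
  · intro n hn
    have hdn : ¬d ∣ n := fun ⟨k, hk⟩ => hn ⟨k, hk.symm⟩
    simp only [coeff_mk, if_neg hdn, Nat.cast_zero, zero_mul]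

theorem constantCoeff_tsum_X_pow_mul {d : ℕ} (hd : d ≠ 0) :
    constantCoeff (∑' j : ℕ, (X : ℕ⟦X⟧) ^ (d * j)) = 1 := by
  rw [(hasSum_X_pow_mul hd).tsum_eq, ← coeff_zero_eq_constantCoeff_apply, coeff_mk,
    if_pos (dvd_zero d)]

/-- The factor `1 - z ^ (i + 1)` that the part `i + 1` contributes to the reciprocal of the
generating function of the partitions with parts in `p`; it is `1` for a part not in `p`. -/
def partFactor (p : ℕ → Prop) [DecidablePred p] (z : ℂ) (i : ℕ) : ℂ :=
  if p (i + 1) then 1 - z ^ (i + 1) else 1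

section PartFactor

variable (p : ℕ → Prop) [DecidablePred p] {z : ℂ}

theorem summable_norm_partFactor_sub_one (hz : ‖z‖ < 1) :
    Summable fun i => ‖partFactor p z i - 1‖ := by
  refine Summable.of_nonneg_of_le (fun i => norm_nonneg _) (fun i => ?_)
    ((summable_geometric_of_lt_one (norm_nonneg z) hz).comp_injective (add_left_injective 1))
  unfold partFactor
  split_ifs
  · simp
  · simp

theorem multipliable_partFactor (hz : ‖z‖ < 1) : Multipliable (partFactor p z) := by
  simpa only [add_sub_cancel] using
    multipliable_one_add_of_summable (summable_norm_partFactor_sub_one p hz)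

theorem tprod_partFactor_ne_zero (hz : ‖z‖ < 1) : ∏' i, partFactor p z i ≠ 0 := by
  have hne : ∀ i, partFactor p z i ≠ 0 := fun i => by
    unfold partFactor
    split_ifs
    · exact one_sub_ne_zero_of_norm_lt_one (norm_pow_lt_one hz i.succ_ne_zero)
    · exact one_ne_zero
  simpa only [add_sub_cancel] using tprod_one_add_ne_zero_of_summable
    (fun i => by simpa only [add_sub_cancel] using hne i) (summable_norm_partFactor_sub_one p hz)

theorem hasSum_card_restricted (hz : ‖z‖ < 1) :
    HasSum (fun n : ℕ => ((Nat.Partition.restricted n p).card : ℂ) * z ^ n)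
      (∏' i, partFactor p z i)⁻¹ := by
  have hvalue : ∀ {x : ℂ}, ‖x‖ < 1 → ∀ i, HasValueAt
      (if p (i + 1) then ∑' j : ℕ, X ^ ((i + 1) * j) else 1) x (partFactor p x i)⁻¹ :=
    fun hx i => by
      unfold partFactor
      split_ifs
      · exact hasValueAt_tsum_X_pow_mul i.succ_ne_zero hx
      · simpa only [inv_one] using HasValueAt.one _
  have hconst : ∀ i, constantCoeff
      (if p (i + 1) then ∑' j : ℕ, (X : ℕ⟦X⟧) ^ ((i + 1) * j) else 1) = 1 := fun i => by
    split_ifs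
    · exact constantCoeff_tsum_X_pow_mul i.succ_ne_zero
    · exact map_one _
  have hnorm : ‖(‖z‖ : ℂ)‖ < 1 := by rwa [Complex.norm_real, norm_norm]
  simpa only [HasValueAt, coeff_mk, Nat.cast_id] using HasValueAt.of_hasProd
    (Nat.Partition.hasProd_powerSeriesMk_card_restricted ℕ p) hconst
    (hvalue hnorm) ((multipliable_partFactor p hnorm).inv₀ (tprod_partFactor_ne_zero p hnorm))
    (hvalue hz) ((multipliable_partFactor p hz).hasProd.inv₀ (tprod_partFactor_ne_zero p hz))

theorem tprod_partFactor_mul_tprod_partFactor_not (hz : ‖z‖ < 1) :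
    (∏' i, partFactor p z i) * ∏' i, partFactor (fun i => ¬p i) z i = eulerE 1 z := by
  rw [← (multipliable_partFactor p hz).tprod_mul (multipliable_partFactor _ hz), eulerE, qProd]
  refine tprod_congr fun i => ?_
  unfold partFactor
  by_cases h : p (i + 1)
  · simp [h, pow_succ']
  · simp [h, pow_succ']

end PartFactor

theorem tprod_partFactor_dvd {l : ℕ} (hl : l ≠ 0) (z : ℂ) :
    ∏' i, partFactor (l ∣ ·) z i = eulerE l z := by
  obtain ⟨m, rfl⟩ := Nat.exists_eq_succ_of_ne_zero hl
  have hsucc : ∀ k, (m + 1) * k + m + 1 = (m + 1) * (k + 1) := fun k => by ring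
  have hinj : Function.Injective fun k => (m + 1) * k + m :=
    (add_left_injective m).comp (mul_right_injective₀ hl)
  rw [eulerE, qProd, ← hinj.tprod_eq]
  · refine tprod_congr fun k => ?_
    rw [partFactor, hsucc, if_pos (dvd_mul_right _ _), pow_mul, pow_succ']
  · refine Function.mulSupport_subset_iff'.2 fun i hi => if_neg fun ⟨k, hk⟩ => hi ?_
    obtain ⟨k, rfl⟩ := Nat.exists_eq_succ_of_ne_zero (by rintro rfl; simp at hk : k ≠ 0)
    exact ⟨k, by simpa [← hsucc] using hk.symm⟩

theorem hasSum_numRegularPartitions {l : ℕ} (hl : l ≠ 0) {z : ℂ} (hz : ‖z‖ < 1) :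
    HasSum (fun n : ℕ => (numRegularPartitions l n : ℂ) * z ^ n) (eulerE l z / eulerE 1 z) := by
  have hval : (∏' i, partFactor (fun i => ¬l ∣ i) z i)⁻¹ = eulerE l z / eulerE 1 z := by
    rw [← tprod_partFactor_mul_tprod_partFactor_not (l ∣ ·) hz, tprod_partFactor_dvd hl,
      div_mul_cancel_left₀ (eulerE_ne_zero hz hl)]
  exact hval ▸ hasSum_card_restricted (fun i => ¬l ∣ i) hz

end GeneratingFunctions

/-! ### The residue class three modulo five -/

theorem summable_residue_class {N : ℕ} {a : ℕ → ℂ} {t : ℂ} (hN : N ≠ 0)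
    (h : Summable fun n => a n * t ^ n) (ht : t ≠ 0) (k : ℕ) :
    Summable fun n => a (N * n + k) * (t ^ N) ^ n := by
  have hinj : Function.Injective fun n => N * n + k :=
    (add_left_injective k).comp (mul_right_injective₀ hN)
  refine ((h.comp_injective hinj).mul_right (t ^ k)⁻¹).congr fun n => ?_
  rw [Function.comp_apply, pow_add, pow_mul, ← mul_assoc,
    mul_inv_cancel_right₀ (pow_ne_zero k ht)]

theorem tsum_mul_pow_eq_sum_residue_classes {N : ℕ} [NeZero N] {a : ℕ → ℂ} {t : ℂ}
    (h : Summable fun n => a n * t ^ n) :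
    ∑' n, a n * t ^ n = ∑ k : Fin N, (∑' n, a (N * n + k) * (t ^ N) ^ n) * t ^ (k : ℕ) := by
  obtain _ | N := N
  · exact absurd rfl (NeZero.ne 0)
  rw [Nat.sumByResidueClasses h (N + 1)]
  refine Finset.sum_congr rfl fun k _ => ?_
  rw [← tsum_mul_right]
  refine tsum_congr fun n => ?_
  rw [ZMod.val, add_comm, pow_add, pow_mul, mul_assoc]

theorem theta_one_one_mul_tsum_numRegularPartitions {s : ℂ} (hs0 : s ≠ 0) (hs : ‖s‖ < 1) :
    theta 1 1 s * ∑' n, (numRegularPartitions 4 n : ℂ) * (-s) ^ n = theta 1 3 s := by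
  have hneg : ‖-s‖ < 1 := by rwa [norm_neg]
  have hφ := theta_one_one_neg_mul (neg_ne_zero.2 hs0) hneg
  have hψ := theta_one_three_neg_mul (neg_ne_zero.2 hs0) hneg
  rw [neg_neg] at hφ hψ
  have h1 := eulerE_ne_zero hneg one_ne_zero
  have h2 := eulerE_ne_zero hneg two_ne_zero
  rw [(hasSum_numRegularPartitions four_ne_zero hneg).tsum_eq, ← mul_div_assoc,
    div_eq_iff h1]
  apply mul_right_cancel₀ h2
  linear_combination eulerE 4 (-s) * hφ - eulerE 1 (-s) * hψ

theorem summable_numRegularPartitions_five_mul_add_three {q : ℂ} (hq0 : q ≠ 0) (hq : ‖q‖ < 1) :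
    Summable fun n : ℕ => (numRegularPartitions 4 (5 * n + 3) : ℂ) * q ^ n := by
  obtain ⟨t, rfl⟩ := IsAlgClosed.exists_pow_nat_eq q (n := 5) (by decide)
  exact summable_residue_class (by decide : 5 ≠ 0) (hasSum_numRegularPartitions four_ne_zero
    (norm_lt_one_of_norm_pow_lt_one hq)).summable (ne_zero_pow (by decide : 5 ≠ 0) hq0) 3

theorem tsum_numRegularPartitions_mul_theta {q : ℂ} (hq0 : q ≠ 0) (hq : ‖q‖ < 1) :
    (∑' n : ℕ, (numRegularPartitions 4 (5 * n + 3) : ℂ) * q ^ n) *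
        (theta 5 5 (-q) * theta 1 1 (-q) ^ 2 * theta 1 3 (-q) ^ 2) =
      theta 5 15 (-q) * (q * theta 5 5 (-q) ^ 2 * theta 5 15 (-q) ^ 2 +
        3 * theta 5 5 (-q) ^ 2 * (theta 2 3 (-q) * theta 1 4 (-q)) +
        4 * q ^ 2 * (theta 3 7 (-q) * theta 1 9 (-q)) * theta 5 15 (-q) ^ 2) := by
  have hy0 : -q ≠ 0 := neg_ne_zero.2 hq0
  have hy : ‖-q‖ < 1 := by rwa [norm_neg]
  have h := theta_quotient_component_three hy0 hy
    (g := fun k => (∑' n, (numRegularPartitions 4 (5 * n + k) : ℂ) * q ^ n) * (-1) ^ (k : ℕ))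
    fun s hs => by
      have hs0 : s ≠ 0 := ne_zero_pow (by decide : 5 ≠ 0) (hs ▸ hy0)
      have hs1 : ‖s‖ < 1 := norm_lt_one_of_norm_pow_lt_one (hs ▸ hy)
      have hneg : (-s) ^ 5 = q := by rw [Odd.neg_pow (by decide), hs, neg_neg]
      rw [← theta_one_one_mul_tsum_numRegularPartitions hs0 hs1,
        tsum_mul_pow_eq_sum_residue_classes (N := 5) (hasSum_numRegularPartitions four_ne_zero
          (by rwa [norm_neg] : ‖-s‖ < 1)).summable, hneg]
      simp only [mul_assoc, ← mul_pow, neg_one_mul]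
  simp only [Fin.isValue, Fin.coe_ofNat_eq_mod] at h
  linear_combination -h

theorem numRegularPartitions_four_three : numRegularPartitions 4 3 = 3 := by
  have himage : (Nat.Partition.restricted 3 fun i => ¬4 ∣ i).image Nat.Partition.parts =
      {s ∈ (Multiset.powerset {1, 1, 1, 2, 3}).toFinset | s.sum = 3} := by
    ext s
    simp only [Finset.mem_image, Finset.mem_filter, Multiset.mem_toFinset, Nat.Partition.restricted,
      Finset.mem_univ, true_and]
    constructor
    · rintro ⟨p, -, rfl⟩
      refine ⟨Multiset.mem_powerset.2 (Multiset.le_iff_count.2 fun i => ?_), p.parts_sum⟩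
      have hcount : p.parts.count i * i ≤ 3 := by
        obtain ⟨t, ht⟩ := Multiset.le_iff_exists_add.1
          (Multiset.le_count_iff_replicate_le.1 (le_refl (p.parts.count i)))
        have hsum := p.parts_sum
        rw [ht, Multiset.sum_add, Multiset.sum_replicate, smul_eq_mul] at hsum
        exact (Nat.le_add_right _ _).trans hsum.le
      by_cases hi : i ∈ p.parts
      · have hi0 := p.parts_pos hi
        have hi3 : i ≤ 3 := p.le_of_mem_parts hi
        interval_cases i
        · exact (by lia : Multiset.count 1 p.parts ≤ 3)
        · exact (by lia : Multiset.count 2 p.parts ≤ 1)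
        · exact (by lia : Multiset.count 3 p.parts ≤ 1)
      · rw [Multiset.count_eq_zero_of_notMem hi]
        exact Nat.zero_le _
    · rintro ⟨hs, hsum⟩
      have hs' : ∀ i ∈ s, 0 < i ∧ ¬4 ∣ i := fun i hi =>
        (by decide : ∀ i ∈ ({1, 1, 1, 2, 3} : Multiset ℕ), 0 < i ∧ ¬4 ∣ i) i
          (Multiset.mem_of_le (Multiset.mem_powerset.1 hs) hi)
      exact ⟨⟨s, fun hi => (hs' _ hi).1, hsum⟩, fun i hi => (hs' i hi).2, rfl⟩
  rw [numRegularPartitions,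
    ← Finset.card_image_of_injective _ fun p p' h => Nat.Partition.ext h, himage]
  decide

theorem theorem3 (q : ℂ) (hq : ‖q‖ < 1) :
    HasSum (fun n : ℕ => (numRegularPartitions 4 (5 * n + 3) : ℂ) * q ^ n)
      (3 * (eulerE 2 q ^ 2 * eulerE 10 q ^ 6) /
          (eulerE 1 q ^ 5 * eulerE 4 q * eulerE 20 q ^ 2)
        + q * (eulerE 2 q ^ 4 * eulerE 5 q ^ 5 * eulerE 20 q ^ 3) /
          (eulerE 1 q ^ 6 * eulerE 4 q ^ 2 * eulerE 10 q ^ 4)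
        + 4 * q ^ 2 * (eulerE 2 q ^ 3 * eulerE 10 q * eulerE 20 q ^ 3) /
          (eulerE 1 q ^ 5 * eulerE 4 q ^ 2)) := by
  rcases eq_or_ne q 0 with rfl | hq0
  · convert hasSum_single 0 fun n hn => ?_ using 1
    · simp [eulerE_zero_right, numRegularPartitions_four_three]
    · simp [hn]
  · have h := tsum_numRegularPartitions_mul_theta hq0 hq
    have h1 := eulerE_ne_zero hq (by decide : 1 ≠ 0)
    have h2 := eulerE_ne_zero hq (by decide : 2 ≠ 0)
    have h4 := eulerE_ne_zero hq (by decide : 4 ≠ 0)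
    have h5 := eulerE_ne_zero hq (by decide : 5 ≠ 0)
    have h10 := eulerE_ne_zero hq (by decide : 10 ≠ 0)
    have h20 := eulerE_ne_zero hq (by decide : 20 ≠ 0)
    rw [eq_div_of_mul_eq h10 (theta_five_five_neg_mul hq0 hq),
      eq_div_of_mul_eq h10 (theta_five_fifteen_neg_mul hq0 hq),
      eq_div_of_mul_eq h2 (theta_one_one_neg_mul hq0 hq),
      eq_div_of_mul_eq h2 (theta_one_three_neg_mul hq0 hq),
      eq_div_of_mul_eq (by positivity) (theta_three_seven_neg_mul_theta_one_nine_neg hq0 hq),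
      eq_div_of_mul_eq (by positivity) (theta_two_three_neg_mul_theta_one_four_neg hq0 hq),
      ← eq_div_iff (by positivity)] at h
    convert (summable_numRegularPartitions_five_mul_add_three hq0 hq).hasSum using 1
    rw [h]
    field_simp
    ring
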